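/- Let $\Delta=\{z\in\mathbb{C}:|z|<1\}$ and let $\rho$ be the Poincaré distance on $\Delta$ given by the density $\frac{1}{1-|z|^2}$, that is, $\rho(a,z)=\operatorname{artanh}\left|\frac{z-a}{1-\overline{a}z}\right|$. Let $X$ be a subdomain of $\Delta$, i.e. a nonempty connected open subset of $\Delta$ ($X=\Delta$ is allowed). Call $X$ a $\rho$-Bloch subdomain of $\Delta$ if $R(X,\Delta)<\infty$, where $R(X,\Delta)\in[0,\infty]$ is the supremum of all $r>0$ such that for some $a\in\Delta$ the hyperbolic disk $\{z\in\Delta:\rho(a,z)<r\}$ is contained in $X$. Call $X$ degenerate in $\Delta$ if for every sequence $f_1,f_2,f_3,\ldots$ of holomorphic maps from $\Delta$ to $X$, every accumulation point of the iterated function system $F_n=f_1\circ f_2\circ\cdots\circ f_n$ is constant on $\Delta$; here an accumulation point is a function $F$ on $\Delta$ to which some subsequence of $(F_n)$ converges uniformly on compact subsets of $\Delta$. Then $X$ is a $\rho$-Bloch subdomain of $\Delta$ if and only if $X$ is degenerate in $\Delta$. -/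

import Mathlib

namespace HolIter

/-- The open unit disk `Δ` of the complex plane. -/
def unitDisk : Set ℂ := Metric.ball (0 : ℂ) 1

/-- The Poincaré distance of the unit disk, for the density `1 / (1 - |z|²)`:
`ρ(a, z) = artanh |(z - a) / (1 - conj a * z)|` for `a`, `z` in `Δ`. -/
noncomputable def rho (a z : ℂ) : ℝ :=
  Real.artanh ‖(z - a) / (1 - (starRingEnd ℂ) a * z)‖

/-- The open hyperbolic disk of `Δ` with center `a` and `ρ`-radius `r`. -/
def hypDisk (a : ℂ) (r : ℝ) : Set ℂ := {z | z ∈ unitDisk ∧ rho a z < r}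

/-- The `ρ`-Bloch radius of `X` in `Δ`: the supremum, in `[0, ∞]`, of the `ρ`-radii of the
hyperbolic disks of `Δ` that are contained in `X`. -/
noncomputable def blochRadius (X : Set ℂ) : ENNReal :=
  sSup {R : ENNReal | ∃ a ∈ unitDisk, ∃ r : ℝ, 0 < r ∧ hypDisk a r ⊆ X ∧ R = ENNReal.ofReal r}

/-- `X` is `ρ`-Bloch in `Δ`: its `ρ`-Bloch radius is finite. -/
def IsRhoBloch (X : Set ℂ) : Prop := blochRadius X < ⊤

/-- `X` is a subdomain of `Δ`: a nonempty connected open subset of `Δ`. -/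
def IsSubdomain (X : Set ℂ) : Prop := IsOpen X ∧ IsConnected X ∧ X ⊆ unitDisk

/-- The holomorphic maps from `Δ` to `X` (only the values on `Δ` matter). -/
def Hol (X : Set ℂ) : Set (ℂ → ℂ) :=
  {f | DifferentiableOn ℂ f unitDisk ∧ Set.MapsTo f unitDisk X}

/-- The iterated function system `f₀, f₀ ∘ f₁, f₀ ∘ f₁ ∘ f₂, …` of the sequence `f`. -/
def iterSystem (f : ℕ → ℂ → ℂ) : ℕ → ℂ → ℂ
  | 0 => f 0
  | n + 1 => iterSystem f n ∘ f (n + 1)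

/-- `G` is an accumulation point of the sequence `F`: some subsequence of `F` converges to `G`
locally uniformly on `Δ`. -/
def IsAccumulationPoint (F : ℕ → ℂ → ℂ) (G : ℂ → ℂ) : Prop :=
  ∃ φ : ℕ → ℕ, StrictMono φ ∧
    TendstoLocallyUniformlyOn (fun k => F (φ k)) G Filter.atTop unitDisk

/-- `X` is degenerate in `Δ`: every accumulation point of every iterated function system formed
from holomorphic maps from `Δ` to `X` is constant on `Δ`. -/
def IsDegenerate (X : Set ℂ) : Prop :=
  ∀ f : ℕ → ℂ → ℂ, (∀ n, f n ∈ Hol X) →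
    ∀ G : ℂ → ℂ, IsAccumulationPoint (iterSystem f) G → ∃ c : ℂ, ∀ z ∈ unitDisk, G z = c

end HolIter

namespace HolIter

open Set Filter Topology Metric ComplexConjugate

/-! Both directions measure maps by the hyperbolic derivative, which is multiplicative under
composition and equals 1 for automorphisms of the disk.

If `X` is Bloch, all holomorphic maps into `X` have hyperbolic derivative at most some `k < 1`.
Otherwise, normalizing by automorphisms would give a self-map fixing 0 with derivative near modulus
1; by `exists_ball_subset_image` its image is so large that `X` would contain a forbidden hyperbolic
disk. Hence the derivatives of the iterated system tend to 0, and so every limit is constant.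

If `X` is not Bloch, it contains disks with centers `a n` and radii `s n`, where `s n ≤ ‖a n‖` and
`∏ s n > 0`. The map `f n` goes into the `n`-th disk through a Blaschke product of degree two, and
sends both 0 and `a (n + 1)` to `a n`. The point `a (n + 1)` continues the chain, while 0 is a fixed
point of observation: the centers approach the unit circle, so derivatives there say nothing about a
limit. The derivatives of the system at 0 stay away from 0, and Montel's theorem yields a
nonconstant limit. -/

theorem mem_unitDisk {z : ℂ} : z ∈ unitDisk ↔ ‖z‖ < 1 := by simp [unitDisk]

theorem isOpen_unitDisk : IsOpen unitDisk := isOpen_ball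

theorem zero_mem_unitDisk : (0 : ℂ) ∈ unitDisk := by simp [unitDisk]

theorem isPreconnected_unitDisk : IsPreconnected unitDisk :=
  (convex_ball (0 : ℂ) 1).isPreconnected

theorem neg_mem_unitDisk {a : ℂ} (ha : a ∈ unitDisk) : -a ∈ unitDisk := by
  simpa [mem_unitDisk] using ha

theorem one_sub_norm_sq_pos {z : ℂ} (hz : z ∈ unitDisk) : 0 < 1 - ‖z‖ ^ 2 := by
  have := mem_unitDisk.1 hz
  nlinarith [norm_nonneg z]

/-! ### Automorphisms of the disk -/

/-- The automorphism of the unit disk that sends `a` to `0`. -/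
noncomputable def diskMap (a z : ℂ) : ℂ := (z - a) / (1 - conj a * z)

theorem one_sub_conj_mul_ne_zero {a z : ℂ} (ha : a ∈ unitDisk) (hz : ‖z‖ ≤ 1) :
    1 - conj a * z ≠ 0 := by
  intro h
  have h1 : ‖conj a * z‖ = 1 := by rw [← sub_eq_zero.1 h, norm_one]
  rw [norm_mul, RCLike.norm_conj] at h1
  have := mem_unitDisk.1 ha
  nlinarith [norm_nonneg a, norm_nonneg z]

theorem norm_one_sub_conj_mul_sq_sub (a z : ℂ) :
    ‖1 - conj a * z‖ ^ 2 - ‖z - a‖ ^ 2 = (1 - ‖a‖ ^ 2) * (1 - ‖z‖ ^ 2) := by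
  simp only [Complex.sq_norm, Complex.normSq_apply, Complex.sub_re, Complex.sub_im,
    Complex.mul_re, Complex.mul_im, Complex.conj_re, Complex.conj_im, Complex.one_re,
    Complex.one_im]
  ring

theorem one_sub_norm_diskMap_sq {a z : ℂ} (ha : a ∈ unitDisk) (hz : ‖z‖ ≤ 1) :
    1 - ‖diskMap a z‖ ^ 2 = (1 - ‖a‖ ^ 2) * (1 - ‖z‖ ^ 2) / ‖1 - conj a * z‖ ^ 2 := by
  have h : ‖1 - conj a * z‖ ≠ 0 := norm_ne_zero_iff.2 (one_sub_conj_mul_ne_zero ha hz)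
  rw [← norm_one_sub_conj_mul_sq_sub, diskMap, norm_div, div_pow, sub_div,
    div_self (pow_ne_zero 2 h)]

theorem norm_diskMap_le_one {a z : ℂ} (ha : a ∈ unitDisk) (hz : ‖z‖ ≤ 1) :
    ‖diskMap a z‖ ≤ 1 := by
  have h1 := one_sub_norm_diskMap_sq ha hz
  have h2 : 0 ≤ (1 - ‖a‖ ^ 2) * (1 - ‖z‖ ^ 2) / ‖1 - conj a * z‖ ^ 2 :=
    div_nonneg (mul_nonneg (one_sub_norm_sq_pos ha).le (by nlinarith [norm_nonneg z]))
      (sq_nonneg _)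
  nlinarith [norm_nonneg (diskMap a z)]

theorem diskMap_mem_unitDisk {a z : ℂ} (ha : a ∈ unitDisk) (hz : z ∈ unitDisk) :
    diskMap a z ∈ unitDisk := by
  have hz' := (mem_unitDisk.1 hz).le
  have h1 := one_sub_norm_diskMap_sq ha hz'
  have h2 : 0 < (1 - ‖a‖ ^ 2) * (1 - ‖z‖ ^ 2) / ‖1 - conj a * z‖ ^ 2 :=
    div_pos (mul_pos (one_sub_norm_sq_pos ha) (one_sub_norm_sq_pos hz))
      (pow_pos (norm_pos_iff.2 (one_sub_conj_mul_ne_zero ha hz')) 2)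
  rw [mem_unitDisk]
  nlinarith [norm_nonneg (diskMap a z)]

theorem diskMap_self (a : ℂ) : diskMap a a = 0 := by simp [diskMap]

theorem diskMap_zero_right (a : ℂ) : diskMap a 0 = -a := by simp [diskMap]

theorem diskMap_neg_diskMap {a z : ℂ} (ha : a ∈ unitDisk) (hz : z ∈ unitDisk) :
    diskMap (-a) (diskMap a z) = z := by
  have h1 : 1 - conj a * z ≠ 0 := one_sub_conj_mul_ne_zero ha (mem_unitDisk.1 hz).le
  have h2 : 1 - conj a * a ≠ 0 := one_sub_conj_mul_ne_zero ha (mem_unitDisk.1 ha).le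
  have h3 : 1 - conj (-a) * diskMap a z ≠ 0 :=
    one_sub_conj_mul_ne_zero (neg_mem_unitDisk ha)
      (mem_unitDisk.1 (diskMap_mem_unitDisk ha hz)).le
  have h4 : diskMap a z * (1 - conj a * z) = z - a := div_mul_cancel₀ _ h1
  rw [diskMap, div_eq_iff h3, map_neg]
  apply mul_right_cancel₀ h1
  linear_combination (1 - conj a * z) * h4

theorem diskMap_diskMap_neg {a z : ℂ} (ha : a ∈ unitDisk) (hz : z ∈ unitDisk) :
    diskMap a (diskMap (-a) z) = z := by
  simpa using diskMap_neg_diskMap (neg_mem_unitDisk ha) hz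

theorem hasDerivAt_diskMap {a z : ℂ} (ha : a ∈ unitDisk) (hz : ‖z‖ ≤ 1) :
    HasDerivAt (diskMap a) ((1 - conj a * a) / (1 - conj a * z) ^ 2) z := by
  have h1 := one_sub_conj_mul_ne_zero ha hz
  have h := ((hasDerivAt_id z).sub_const a).div
    (((hasDerivAt_id z).const_mul (conj a)).const_sub 1) h1
  refine h.congr_deriv ?_
  congr 1
  simp only [id]
  ring

theorem differentiableOn_diskMap {a : ℂ} (ha : a ∈ unitDisk) :
    DifferentiableOn ℂ (diskMap a) (closedBall 0 1) := fun _ hz =>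
  (hasDerivAt_diskMap ha (by simpa using hz)).differentiableAt.differentiableWithinAt

theorem norm_one_sub_conj_mul_self {a : ℂ} (ha : a ∈ unitDisk) :
    ‖1 - conj a * a‖ = 1 - ‖a‖ ^ 2 := by
  rw [Complex.conj_mul', ← Complex.ofReal_one, ← Complex.ofReal_pow, ← Complex.ofReal_sub,
    Complex.norm_real, Real.norm_of_nonneg (one_sub_norm_sq_pos ha).le]

/-! ### Hyperbolic derivative and composition -/

/-- The derivative of `f` with respect to the hyperbolic metric of the unit disk. -/
noncomputable def hypDeriv (f : ℂ → ℂ) (z : ℂ) : ℝ :=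
  ‖deriv f z‖ * (1 - ‖z‖ ^ 2) / (1 - ‖f z‖ ^ 2)

theorem hypDeriv_nonneg {f : ℂ → ℂ} {z : ℂ} (hz : z ∈ unitDisk) (hf : f z ∈ unitDisk) :
    0 ≤ hypDeriv f z :=
  div_nonneg (mul_nonneg (norm_nonneg _) (one_sub_norm_sq_pos hz).le) (one_sub_norm_sq_pos hf).le

theorem hypDeriv_diskMap {a z : ℂ} (ha : a ∈ unitDisk) (hz : z ∈ unitDisk) :
    hypDeriv (diskMap a) z = 1 := by
  have hz' := (mem_unitDisk.1 hz).le
  have h1 : ‖1 - conj a * z‖ ≠ 0 := norm_ne_zero_iff.2 (one_sub_conj_mul_ne_zero ha hz')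
  have h2 := (one_sub_norm_sq_pos ha).ne'
  have h3 := (one_sub_norm_sq_pos hz).ne'
  rw [hypDeriv, (hasDerivAt_diskMap ha hz').deriv, one_sub_norm_diskMap_sq ha hz', norm_div,
    norm_pow, norm_one_sub_conj_mul_self ha]
  field_simp

theorem hypDeriv_comp {f g : ℂ → ℂ} {z : ℂ} (hf : DifferentiableAt ℂ f (g z))
    (hg : DifferentiableAt ℂ g z) (hgz : g z ∈ unitDisk) :
    hypDeriv (f ∘ g) z = hypDeriv f (g z) * hypDeriv g z := by
  have h := (one_sub_norm_sq_pos hgz).ne'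
  rw [hypDeriv, hypDeriv, hypDeriv, deriv_comp z hf hg, norm_mul, Function.comp]
  field_simp

theorem Hol.differentiableAt {X : Set ℂ} {f : ℂ → ℂ} (hf : f ∈ Hol X) {z : ℂ}
    (hz : z ∈ unitDisk) : DifferentiableAt ℂ f z :=
  hf.1.differentiableAt (isOpen_unitDisk.mem_nhds hz)

theorem Hol.comp {X Y : Set ℂ} (hX : X ⊆ unitDisk) {f g : ℂ → ℂ} (hf : f ∈ Hol Y)
    (hg : g ∈ Hol X) : f ∘ g ∈ Hol Y :=
  ⟨hf.1.comp hg.1 (fun _ hz => hX (hg.2 hz)), fun _ hz => hf.2 (hX (hg.2 hz))⟩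

theorem Hol.mono {X Y : Set ℂ} (hXY : X ⊆ Y) {f : ℂ → ℂ} (hf : f ∈ Hol X) : f ∈ Hol Y :=
  ⟨hf.1, hf.2.mono_right hXY⟩

theorem diskMap_mem_hol {a : ℂ} (ha : a ∈ unitDisk) : diskMap a ∈ Hol unitDisk :=
  ⟨(differentiableOn_diskMap ha).mono ball_subset_closedBall,
    fun _ hz => diskMap_mem_unitDisk ha hz⟩

theorem iterSystem_mem_hol {X : Set ℂ} (hX : X ⊆ unitDisk) {f : ℕ → ℂ → ℂ}
    (hf : ∀ n, f n ∈ Hol X) (n : ℕ) : iterSystem f n ∈ Hol X := by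
  induction n with
  | zero => exact hf 0
  | succ n ih => exact Hol.comp hX ih (hf (n + 1))

theorem hypDeriv_iterSystem_succ {X : Set ℂ} (hX : X ⊆ unitDisk) {f : ℕ → ℂ → ℂ}
    (hf : ∀ n, f n ∈ Hol X) (n : ℕ) {z : ℂ} (hz : z ∈ unitDisk) :
    hypDeriv (iterSystem f (n + 1)) z =
      hypDeriv (iterSystem f n) (f (n + 1) z) * hypDeriv (f (n + 1)) z :=
  have h := hX ((hf (n + 1)).2 hz)
  hypDeriv_comp (Hol.differentiableAt (iterSystem_mem_hol hX hf n) h)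
    (Hol.differentiableAt (hf (n + 1)) hz) h

/-! ### Bloch radius in terms of pseudohyperbolic disks -/

/-- The pseudohyperbolic disk with center `a` and radius `t`. -/
def pseudoDisk (a : ℂ) (t : ℝ) : Set ℂ := {z | z ∈ unitDisk ∧ ‖diskMap a z‖ < t}

theorem rho_eq (a z : ℂ) : rho a z = Real.artanh ‖diskMap a z‖ := rfl

theorem hypDisk_subset_pseudoDisk {a : ℂ} (ha : a ∈ unitDisk) (r : ℝ) :
    hypDisk a r ⊆ pseudoDisk a (Real.tanh r) := by
  rintro z ⟨hz, hr⟩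
  refine ⟨hz, ?_⟩
  by_contra! h
  have h1 := mem_unitDisk.1 (diskMap_mem_unitDisk ha hz)
  have h2 := Real.artanh_le_artanh (Real.neg_one_lt_tanh r) h1 h
  rw [Real.artanh_tanh, ← rho_eq] at h2
  exact absurd hr h2.not_gt

theorem pseudoDisk_subset_hypDisk {a : ℂ} {t r : ℝ} (ht : t < 1) (hr : Real.artanh t ≤ r) :
    pseudoDisk a t ⊆ hypDisk a r := by
  rintro z ⟨hz, h⟩
  refine ⟨hz, lt_of_lt_of_le ?_ hr⟩
  exact Real.artanh_lt_artanh (neg_one_lt_zero.trans_le (norm_nonneg _)) ht h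

theorem IsRhoBloch.exists_not_pseudoDisk_subset {X : Set ℂ} (hX : IsRhoBloch X) :
    ∃ t < 1, 0 < t ∧ ∀ a ∈ unitDisk, ¬ pseudoDisk a t ⊆ X := by
  have hpos : 0 < (blochRadius X).toReal + 1 := by positivity
  refine ⟨Real.tanh ((blochRadius X).toReal + 1), Real.tanh_lt_one _, ?_, fun a ha h => ?_⟩
  · rw [Real.tanh_eq_sinh_div_cosh]
    exact div_pos (Real.sinh_pos_iff.2 hpos) (Real.cosh_pos _)
  · have h1 : ENNReal.ofReal ((blochRadius X).toReal + 1) ≤ blochRadius X :=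
      le_sSup ⟨a, ha, _, hpos, (hypDisk_subset_pseudoDisk ha _).trans h, rfl⟩
    rw [ENNReal.ofReal_le_iff_le_toReal (LT.lt.ne hX)] at h1
    linarith

theorem exists_pseudoDisk_subset_of_not_isRhoBloch {X : Set ℂ} (hX : ¬ IsRhoBloch X) {t : ℝ}
    (ht : t < 1) : ∃ a ∈ unitDisk, pseudoDisk a t ⊆ X := by
  have h : ENNReal.ofReal (Real.artanh t) < blochRadius X := by
    rw [IsRhoBloch, not_lt, top_le_iff] at hX
    rw [hX]
    exact ENNReal.ofReal_lt_top
  obtain ⟨_, ⟨a, ha, r, hr, hsub, rfl⟩, hlt⟩ := lt_sSup_iff.1 h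
  exact ⟨a, ha, (pseudoDisk_subset_hypDisk ht
    ((ENNReal.ofReal_lt_ofReal_iff hr).1 hlt).le).trans hsub⟩

/-- If `X` is not Bloch, it contains pseudohyperbolic disks of radius close to `1` whose centers
are close to the unit circle. -/
theorem exists_pseudoDisk_subset_le_norm {X : Set ℂ} (hX : ¬ IsRhoBloch X) {s : ℝ}
    (hs0 : 0 < s) (hs1 : s < 1) : ∃ a ∈ unitDisk, s ≤ ‖a‖ ∧ pseudoDisk a s ⊆ X := by
  by_cases hX' : unitDisk ⊆ X
  · have h : ‖(s : ℂ)‖ = s := by simp [abs_of_pos hs0]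
    exact ⟨s, mem_unitDisk.2 (h.trans_lt hs1), h.ge, fun z hz => hX' hz.1⟩
  obtain ⟨p, hp, hpX⟩ := not_subset.1 hX'
  have hp1 := one_sub_norm_sq_pos hp
  -- The omitted point `p` forces `(1 - ‖a‖ ^ 2) * (1 - ‖p‖ ^ 2) ≤ u * ‖1 - conj a * p‖ ^ 2 ≤ 4 *
  -- u`, so this `u` gives `s ≤ ‖a‖`.
  set u : ℝ := (1 - s ^ 2) * (1 - ‖p‖ ^ 2) / 4 with hu
  have hs2 : 0 < 1 - s ^ 2 := by nlinarith
  have hu0 : 0 < u := by positivity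
  have hu1 : u ≤ (1 - s ^ 2) := by nlinarith [sq_nonneg ‖p‖]
  have ht2 : Real.sqrt (1 - u) ^ 2 = 1 - u := Real.sq_sqrt (by nlinarith)
  have ht1 : Real.sqrt (1 - u) < 1 := by
    rw [Real.sqrt_lt' one_pos]; linarith
  have hst : s ≤ Real.sqrt (1 - u) := Real.le_sqrt_of_sq_le (by linarith)
  obtain ⟨a, ha, hsub⟩ := exists_pseudoDisk_subset_of_not_isRhoBloch hX ht1
  refine ⟨a, ha, ?_, fun z hz => hsub ⟨hz.1, hz.2.trans_le hst⟩⟩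
  have hle : Real.sqrt (1 - u) ≤ ‖diskMap a p‖ := by
    by_contra! h
    exact hpX (hsub ⟨hp, h⟩)
  have h1 := one_sub_norm_diskMap_sq ha (mem_unitDisk.1 hp).le
  have h2 : 1 - ‖diskMap a p‖ ^ 2 ≤ u := by
    nlinarith [Real.sqrt_nonneg (1 - u)]
  have h3 : 0 < ‖1 - conj a * p‖ :=
    norm_pos_iff.2 (one_sub_conj_mul_ne_zero ha (mem_unitDisk.1 hp).le)
  have h4 : ‖1 - conj a * p‖ ≤ 2 := by
    refine (norm_sub_le _ _).trans ?_
    rw [norm_one, norm_mul, RCLike.norm_conj]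
    nlinarith [mem_unitDisk.1 ha, mem_unitDisk.1 hp, norm_nonneg a, norm_nonneg p]
  rw [h1, div_le_iff₀ (by positivity)] at h2
  have h5 : u * ‖1 - conj a * p‖ ^ 2 ≤ u * 4 := by gcongr; nlinarith
  have h6 : 1 - ‖a‖ ^ 2 ≤ 1 - s ^ 2 := by
    refine le_of_mul_le_mul_right ?_ hp1
    linarith
  exact le_of_sq_le_sq (by linarith) (norm_nonneg a)

/-! ### Covering and uniform contraction -/

/-- A holomorphic function on the unit disk that is bounded by `1` stays close to its value at `0`
if this value is close to the unit circle. -/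
theorem norm_sub_le_of_norm_le_one {h : ℂ → ℂ} (hd : DifferentiableOn ℂ h unitDisk)
    (hb : ∀ z ∈ unitDisk, ‖h z‖ ≤ 1) {z : ℂ} {r : ℝ} (hz : ‖z‖ ≤ r) (hr : r < 1) :
    ‖h z - h 0‖ * (1 - r) ≤ r * (1 - ‖h 0‖ ^ 2) := by
  have hzD : z ∈ unitDisk := mem_unitDisk.2 (hz.trans_lt hr)
  have hr0 : 0 ≤ r := (norm_nonneg z).trans hz
  rcases (hb 0 zero_mem_unitDisk).eq_or_lt with h0 | h0
  · have hmax : IsMaxOn (norm ∘ h) unitDisk 0 := fun w hw => by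
      simpa [h0] using hb w hw
    have := Complex.eqOn_of_isPreconnected_of_isMaxOn_norm isPreconnected_unitDisk
      isOpen_unitDisk hd zero_mem_unitDisk hmax hzD
    rw [this, h0]
    simp
  have hc : h 0 ∈ unitDisk := mem_unitDisk.2 h0
  -- Schwarz lemma for `diskMap (h 0) ∘ h`; the case `‖h 0‖ = 1` was settled by the maximum
  -- principle.
  have hS : ‖diskMap (h 0) (h z)‖ ≤ ‖z‖ := by
    refine Complex.norm_le_norm_of_mapsTo_ball (f := diskMap (h 0) ∘ h) (R := 1)
      ((differentiableOn_diskMap hc).comp hd fun w hw => ?_) (fun w hw => ?_)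
      (diskMap_self _) (mem_unitDisk.1 hzD)
    · simpa using hb w hw
    · simpa using norm_diskMap_le_one hc (hb w hw)
  have hne : 0 < ‖1 - conj (h 0) * h z‖ :=
    norm_pos_iff.2 (one_sub_conj_mul_ne_zero hc (hb z hzD))
  rw [diskMap, norm_div, div_le_iff₀ hne] at hS
  have hsplit : ‖1 - conj (h 0) * h z‖ ≤ (1 - ‖h 0‖ ^ 2) + ‖h z - h 0‖ := by
    have : 1 - conj (h 0) * h z = (1 - conj (h 0) * h 0) - conj (h 0) * (h z - h 0) := by ring
    rw [this]
    refine (norm_sub_le _ _).trans ?_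
    rw [norm_one_sub_conj_mul_self hc, norm_mul, RCLike.norm_conj]
    gcongr
    exact mul_le_of_le_one_left (norm_nonneg _) h0.le
  have : ‖h z - h 0‖ ≤ r * ((1 - ‖h 0‖ ^ 2) + ‖h z - h 0‖) :=
    hS.trans (mul_le_mul hz hsplit hne.le hr0)
  linarith

/-- A holomorphic self-map of the unit disk fixing `0` whose derivative at `0` is close to the unit
circle covers a large disk. -/
theorem exists_ball_subset_image {t : ℝ} (ht0 : 0 < t) (ht1 : t < 1) :
    ∃ k < 1, 0 ≤ k ∧ ∀ g ∈ Hol unitDisk, g 0 = 0 → k < ‖deriv g 0‖ →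
      ball 0 t ⊆ g '' unitDisk := by
  obtain ⟨r, htr, hr1⟩ := exists_between ht1
  have hr0 : 0 < r := ht0.trans htr
  have hr1' : 0 < 1 - r := by linarith
  -- The right side, at `a = ‖g' 0‖`, will bound `‖g‖` from below on the circle of radius `r`; it
  -- tends to `r > t` as `a → 1`.
  have hev : ∀ᶠ a : ℝ in 𝓝 1, t < r * (a - r * (1 - a ^ 2) / (1 - r)) := by
    have hc : Continuous fun a : ℝ => r * (a - r * (1 - a ^ 2) / (1 - r)) := by fun_prop
    refine continuousAt_const.eventually_lt hc.continuousAt ?_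
    simpa using htr
  obtain ⟨l, hl, hl'⟩ := exists_Ioc_subset_of_mem_nhds hev ⟨0, one_pos⟩
  -- The maximum with 0 also forces `g' 0 ≠ 0`, which excludes constant `g` in the open mapping
  -- step.
  refine ⟨max l 0, max_lt hl one_pos, le_max_right _ _, fun g hg hg0 hk => ?_⟩
  have hmaps : MapsTo g (ball 0 1) (closedBall (g 0) 1) := fun z hz => by
    rw [hg0]; exact ball_subset_closedBall (hg.2 hz)
  set h : ℂ → ℂ := dslope g 0 with hh
  have h0 : h 0 = deriv g 0 := dslope_same g 0
  have hd : DifferentiableOn ℂ h unitDisk :=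
    (Complex.differentiableOn_dslope (isOpen_unitDisk.mem_nhds zero_mem_unitDisk)).2 hg.1
  have hb : ∀ z ∈ unitDisk, ‖h z‖ ≤ 1 := fun z hz => by
    simpa using Complex.norm_dslope_le_div_of_mapsTo_ball hg.1 hmaps hz
  have hgh : ∀ z, g z = z * h z := fun z => by
    have := sub_smul_dslope g 0 z
    simpa [hg0] using this.symm
  have hrad : t < r * (‖h 0‖ - r * (1 - ‖h 0‖ ^ 2) / (1 - r)) :=
    hl' ⟨by rw [h0]; exact (le_max_left _ _).trans_lt hk, hb 0 zero_mem_unitDisk⟩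
  have hsphere : ∀ z, ‖z‖ = r → t < ‖g z‖ := fun z hz => by
    have h1 := norm_sub_le_of_norm_le_one hd hb hz.le hr1
    rw [← le_div_iff₀ hr1'] at h1
    have h2 : ‖h 0‖ - ‖h z - h 0‖ ≤ ‖h z‖ := by
      rw [sub_le_iff_le_add, norm_sub_rev]
      exact norm_le_norm_add_norm_sub' _ _ |>.trans_eq (by ring)
    rw [hgh, norm_mul, hz]
    refine hrad.trans_le (mul_le_mul_of_nonneg_left ?_ hr0.le)
    linarith
  have hsub : closedBall (0 : ℂ) r ⊆ unitDisk := closedBall_subset_ball hr1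
  have hopen : IsOpen (g '' ball 0 r) := by
    rcases (hg.1.analyticOnNhd isOpen_unitDisk).is_constant_or_isOpen
      isPreconnected_unitDisk with ⟨w, hw⟩ | ho
    · have : g =ᶠ[𝓝 0] fun _ => w :=
        eventually_of_mem (isOpen_unitDisk.mem_nhds zero_mem_unitDisk) hw
      rw [this.deriv_eq, deriv_const, norm_zero] at hk
      exact absurd hk (le_max_right l 0).not_gt
    · exact ho _ (ball_subset_closedBall.trans hsub) isOpen_ball
  have hclosed : IsClosed (g '' closedBall 0 r) :=
    ((isCompact_closedBall 0 r).image_of_continuousOn (hg.1.continuousOn.mono hsub)).isClosed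
  -- The circle of radius `r` is mapped outside `ball 0 t`, so this connected ball is covered by two
  -- disjoint open sets: the image of the open disk and the complement of the image of the closed
  -- one. It meets the first at 0.
  refine (IsPreconnected.subset_left_of_subset_union hopen hclosed.isOpen_compl
    ?_ ?_ ?_ (convex_ball (0 : ℂ) t).isPreconnected).trans
    (image_mono (ball_subset_closedBall.trans hsub))
  · exact disjoint_compl_right.mono_left (image_mono ball_subset_closedBall)
  · intro w hw
    by_cases hw' : w ∈ g '' closedBall 0 r
    · left
      obtain ⟨z, hz, rfl⟩ := hw'
      refine ⟨z, ?_, rfl⟩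
      rw [mem_closedBall_zero_iff] at hz
      rw [mem_ball_zero_iff] at hw ⊢
      exact hz.lt_of_ne fun hzr => (hsphere z hzr).not_gt hw
    · exact Or.inr hw'
  · exact ⟨0, mem_ball_self ht0, 0, mem_ball_self hr0, hg0⟩

/-- Holomorphic maps into a Bloch subdomain uniformly contract the hyperbolic metric. -/
theorem IsRhoBloch.exists_hypDeriv_le {X : Set ℂ} (hX : X ⊆ unitDisk) (hB : IsRhoBloch X) :
    ∃ k < 1, 0 ≤ k ∧ ∀ f ∈ Hol X, ∀ z ∈ unitDisk, hypDeriv f z ≤ k := by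
  obtain ⟨t, ht1, ht0, ht⟩ := hB.exists_not_pseudoDisk_subset
  obtain ⟨k, hk1, hk0, hk⟩ := exists_ball_subset_image ht0 ht1
  refine ⟨k, hk1, hk0, fun f hf z hz => ?_⟩
  by_contra! hlt
  have hfz : f z ∈ unitDisk := hX (hf.2 hz)
  have hz' : diskMap (-z) 0 = z := by simp [diskMap_zero_right]
  have hm := diskMap_mem_hol (neg_mem_unitDisk hz)
  have hfD : f ∈ Hol unitDisk := Hol.mono hX hf
  have hfm : f ∘ diskMap (-z) ∈ Hol unitDisk := Hol.comp Subset.rfl hfD hm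
  have hg := Hol.comp Subset.rfl (diskMap_mem_hol hfz) hfm
  have hg0 : (diskMap (f z) ∘ f ∘ diskMap (-z)) 0 = 0 := by
    simp [hz', diskMap_self]
  have hderiv : hypDeriv (diskMap (f z) ∘ f ∘ diskMap (-z)) 0 = hypDeriv f z := by
    rw [hypDeriv_comp (Hol.differentiableAt (diskMap_mem_hol hfz) (hfm.2 zero_mem_unitDisk))
      (Hol.differentiableAt hfm zero_mem_unitDisk) (hfm.2 zero_mem_unitDisk),
      hypDeriv_diskMap hfz (hfm.2 zero_mem_unitDisk),
      hypDeriv_comp (Hol.differentiableAt hf (hm.2 zero_mem_unitDisk))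
        (Hol.differentiableAt hm zero_mem_unitDisk) (hm.2 zero_mem_unitDisk),
      hypDeriv_diskMap (neg_mem_unitDisk hz) zero_mem_unitDisk, hz', one_mul, mul_one]
  have hnorm : ‖deriv (diskMap (f z) ∘ f ∘ diskMap (-z)) 0‖ = hypDeriv f z := by
    rw [← hderiv, hypDeriv, hg0]
    simp
  refine ht (f z) hfz fun w hw => ?_
  obtain ⟨u, hu, huw⟩ := hk _ hg hg0 (hnorm ▸ hlt) (mem_ball_zero_iff.2 hw.2)
  have hu' : f (diskMap (-z) u) = w := by
    rw [← diskMap_neg_diskMap hfz hw.1, ← huw]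
    exact (diskMap_neg_diskMap hfz (hfm.2 hu)).symm
  exact hu' ▸ hf.2 (hm.2 hu)

/-! ### Bloch subdomains are degenerate -/

theorem hypDeriv_iterSystem_le {X : Set ℂ} (hX : X ⊆ unitDisk) {k : ℝ} (hk0 : 0 ≤ k)
    (hk : ∀ f ∈ Hol X, ∀ z ∈ unitDisk, hypDeriv f z ≤ k) {f : ℕ → ℂ → ℂ}
    (hf : ∀ n, f n ∈ Hol X) (n : ℕ) {z : ℂ} (hz : z ∈ unitDisk) :
    hypDeriv (iterSystem f n) z ≤ k ^ (n + 1) := by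
  induction n generalizing z with
  | zero => simpa [iterSystem] using hk _ (hf 0) z hz
  | succ n ih =>
    have hz' := hX ((hf (n + 1)).2 hz)
    rw [hypDeriv_iterSystem_succ hX hf n hz, pow_succ]
    exact mul_le_mul (ih hz') (hk _ (hf _) z hz) (hypDeriv_nonneg hz hz') (by positivity)

theorem IsRhoBloch.isDegenerate {X : Set ℂ} (hX : X ⊆ unitDisk) (hB : IsRhoBloch X) :
    IsDegenerate X := by
  obtain ⟨k, hk1, hk0, hk⟩ := hB.exists_hypDeriv_le hX
  rintro f hf G ⟨φ, hφ, hG⟩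
  have hF := fun n => iterSystem_mem_hol hX hf n
  have hd : ∀ᶠ n in atTop, DifferentiableOn ℂ (iterSystem f (φ n)) unitDisk :=
    Eventually.of_forall fun n => (hF (φ n)).1
  refine isOpen_unitDisk.exists_is_const_of_deriv_eq_zero isPreconnected_unitDisk
    (hG.differentiableOn hd isOpen_unitDisk) fun z hz => ?_
  have h1 : Tendsto (fun n => deriv (iterSystem f (φ n)) z) atTop (𝓝 (deriv G z)) :=
    (hG.deriv hd isOpen_unitDisk).tendsto_at hz
  refine tendsto_nhds_unique h1 (squeeze_zero_norm (a := fun n => k ^ (φ n + 1) / (1 - ‖z‖ ^ 2))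
    (fun n => ?_) ?_)
  · have hz1 := one_sub_norm_sq_pos hz
    have hFz := one_sub_norm_sq_pos (hX ((hF (φ n)).2 hz))
    have h2 := hypDeriv_iterSystem_le hX hk0 hk hf (φ n) hz
    rw [hypDeriv, div_le_iff₀ hFz] at h2
    rw [le_div_iff₀ hz1]
    refine h2.trans (mul_le_of_le_one_right (by positivity) ?_)
    linarith [sq_nonneg ‖iterSystem f (φ n) z‖]
  · simpa using (((tendsto_pow_atTop_nhds_zero_of_lt_one hk0 hk1).comp
      ((tendsto_add_atTop_nat 1).comp hφ.tendsto_atTop)).div_const (1 - ‖z‖ ^ 2))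

/-! ### Montel's theorem via Arzelà–Ascoli -/

/-- A **Montel theorem**: a sequence of holomorphic functions on the unit disk that is bounded by
`1` has a locally uniformly convergent subsequence. -/
theorem exists_isAccumulationPoint {F : ℕ → ℂ → ℂ}
    (hd : ∀ n, DifferentiableOn ℂ (F n) unitDisk)
    (hb : ∀ n, ∀ z ∈ unitDisk, ‖F n z‖ ≤ 1) : ∃ G, IsAccumulationPoint F G := by
  classical
  -- Closed under pointwise limits, so Tychonoff applies, and strong enough for equicontinuity. The
  -- Lipschitz bound is Schwarz's lemma on the disk of radius `1 - ‖z‖` around `z`, where values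
  -- differ by at most 2.
  let P : (unitDisk → ℂ) → Prop := fun f => (∀ z, ‖f z‖ ≤ 1) ∧
    ∀ z w : unitDisk, ‖(w : ℂ) - z‖ < 1 - ‖(z : ℂ)‖ →
      ‖f w - f z‖ ≤ 2 / (1 - ‖(z : ℂ)‖) * ‖(w : ℂ) - z‖
  have hnear : ∀ z : unitDisk, ∀ᶠ w : unitDisk in 𝓝 z, ‖(w : ℂ) - z‖ < 1 - ‖(z : ℂ)‖ := by
    intro z
    have hc : Continuous fun w : unitDisk => ‖(w : ℂ) - z‖ := by fun_prop
    refine hc.continuousAt.eventually_lt continuousAt_const ?_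
    simpa using mem_unitDisk.1 z.2
  have hlim : ∀ z : unitDisk, Tendsto
      (fun w : unitDisk => 2 / (1 - ‖(z : ℂ)‖) * ‖(w : ℂ) - z‖) (𝓝 z) (𝓝 0) := by
    intro z
    have hc : Continuous fun w : unitDisk => 2 / (1 - ‖(z : ℂ)‖) * ‖(w : ℂ) - z‖ := by fun_prop
    simpa using hc.tendsto z
  have hcont : ∀ f, P f → Continuous f := by
    intro f hf
    rw [continuous_iff_continuousAt]
    intro z
    rw [ContinuousAt, tendsto_iff_norm_sub_tendsto_zero]
    refine squeeze_zero' (Eventually.of_forall fun _ => norm_nonneg _) ?_ (hlim z)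
    filter_upwards [hnear z] with w hw using hf.2 z w hw
  let S : Set C(unitDisk, ℂ) := {f | P f}
  have himage : ContinuousMap.toFun '' S = {f | P f} := by
    ext f
    constructor
    · rintro ⟨g, hg, rfl⟩
      exact hg
    · intro hf
      exact ⟨⟨f, hcont f hf⟩, hf, rfl⟩
  have hcompact : IsCompact (ContinuousMap.toFun '' S) := by
    rw [himage]
    refine (isCompact_univ_pi fun _ : unitDisk => isCompact_closedBall (0 : ℂ) 1).of_isClosed_subset
      ?_ fun f hf z _ => by simpa using hf.1 z
    simp only [P, ofPred_and, ofPred_forall]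
    refine (isClosed_iInter fun z => isClosed_le (by fun_prop) continuous_const).inter
      (isClosed_iInter fun z => isClosed_iInter fun w => isClosed_iInter fun _ =>
        isClosed_le (by fun_prop) continuous_const)
  have hequi : Equicontinuous ((↑) : S → unitDisk → ℂ) := by
    intro z
    refine Metric.equicontinuousAt_of_continuity_modulus
      (fun w : unitDisk => 2 / (1 - ‖(z : ℂ)‖) * ‖(w : ℂ) - z‖) (hlim z) _ ?_
    filter_upwards [hnear z] with w hw f
    rw [dist_comm, dist_eq_norm]
    exact f.2.2 z w hw
  have hS : IsCompact S := ArzelaAscoli.isCompact_of_equicontinuous S hcompact hequi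
  have hP : ∀ n, P (fun z => F n z) := by
    refine fun n => ⟨fun z => hb n z z.2, fun z w hw => ?_⟩
    have hsub : ball (z : ℂ) (1 - ‖(z : ℂ)‖) ⊆ unitDisk := by
      refine ball_subset_ball' ?_
      rw [dist_zero_right]
      linarith
    have h := Complex.dist_le_div_mul_dist_of_mapsTo_ball (R₂ := 2) ((hd n).mono hsub)
      (fun x hx => ?_) (show (w : ℂ) ∈ ball (z : ℂ) (1 - ‖(z : ℂ)‖) by
        rwa [mem_ball, dist_eq_norm])
    · rwa [dist_eq_norm, dist_eq_norm] at h
    · rw [mem_closedBall, dist_eq_norm]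
      refine (norm_sub_le _ _).trans ?_
      linarith [hb n x (hsub hx), hb n z z.2]
  have : LocallyCompactSpace unitDisk := isOpen_unitDisk.locallyCompactSpace
  obtain ⟨g, -, φ, hφ, hg⟩ := hS.isSeqCompact
    (x := fun n => (⟨fun z => F n z, hcont _ (hP n)⟩ : C(unitDisk, ℂ))) hP
  refine ⟨fun z => if h : z ∈ unitDisk then g ⟨z, h⟩ else 0, φ, hφ, ?_⟩
  rw [tendstoLocallyUniformlyOn_iff_tendstoLocallyUniformly_comp_coe]
  have hG : (fun z => if h : z ∈ unitDisk then g ⟨z, h⟩ else 0) ∘ Subtype.val = g :=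
    funext fun z : unitDisk => dif_pos z.2
  rw [hG]
  exact ContinuousMap.tendsto_iff_tendstoLocallyUniformly.1 hg

/-! ### Non-Bloch subdomains are not degenerate -/

/-- A map of degree two from the unit disk onto the pseudohyperbolic disk with center `a` and
radius `s`, which sends `0` and `b` to the center. -/
noncomputable def doubleCover (a b : ℂ) (s : ℝ) : ℂ → ℂ :=
  diskMap (-a) ∘ fun z => s * (z * diskMap b z)

section DoubleCover

variable {a b : ℂ} {s : ℝ}

theorem norm_mul_diskMap_lt (hb : b ∈ unitDisk) (hs0 : 0 < s) {z : ℂ} (hz : z ∈ unitDisk) :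
    ‖(s : ℂ) * (z * diskMap b z)‖ < s := by
  have h1 := mem_unitDisk.1 hz
  have h2 := mem_unitDisk.1 (diskMap_mem_unitDisk hb hz)
  rw [norm_mul, norm_mul, Complex.norm_real, Real.norm_of_nonneg hs0.le]
  exact mul_lt_of_lt_one_right hs0 (mul_lt_one_of_nonneg_of_lt_one_left (norm_nonneg _) h1 h2.le)

theorem hasDerivAt_mul_diskMap (hb : b ∈ unitDisk) (s : ℝ) {z : ℂ} (hz : z ∈ unitDisk) :
    HasDerivAt (fun z => (s : ℂ) * (z * diskMap b z))
      (s * (diskMap b z + z * ((1 - conj b * b) / (1 - conj b * z) ^ 2))) z := by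
  simpa using ((hasDerivAt_id z).mul
    (hasDerivAt_diskMap hb (mem_unitDisk.1 hz).le)).const_mul (s : ℂ)

theorem mul_diskMap_mem_hol (hb : b ∈ unitDisk) (hs0 : 0 < s) (hs1 : s < 1) :
    (fun z => (s : ℂ) * (z * diskMap b z)) ∈ Hol unitDisk :=
  ⟨fun _ hz => (hasDerivAt_mul_diskMap hb s hz).differentiableAt.differentiableWithinAt,
    fun _ hz => mem_unitDisk.2 ((norm_mul_diskMap_lt hb hs0 hz).trans hs1)⟩

theorem doubleCover_mem_hol (ha : a ∈ unitDisk) (hb : b ∈ unitDisk) (hs0 : 0 < s) (hs1 : s < 1) :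
    doubleCover a b s ∈ Hol (pseudoDisk a s) := by
  have hB := mul_diskMap_mem_hol hb hs0 hs1
  have h := Hol.comp Subset.rfl (diskMap_mem_hol (neg_mem_unitDisk ha)) hB
  refine ⟨h.1, fun z hz => ⟨h.2 hz, ?_⟩⟩
  rw [doubleCover, Function.comp, diskMap_diskMap_neg ha (hB.2 hz)]
  exact norm_mul_diskMap_lt hb hs0 hz

theorem doubleCover_zero (a b : ℂ) (s : ℝ) : doubleCover a b s 0 = a := by
  simp [doubleCover, diskMap_zero_right]

theorem doubleCover_self (a b : ℂ) (s : ℝ) : doubleCover a b s b = a := by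
  simp [doubleCover, diskMap_zero_right, diskMap_self]

/-- At 0 the Blaschke product `z * diskMap b z` has derivative `-b`; at `b` its derivative has
modulus `‖b‖ / (1 - ‖b‖ ^ 2)`. Both zeros thus give hyperbolic derivative `‖b‖`, scaled by `s`; the
outer automorphism changes nothing. -/
theorem hypDeriv_doubleCover (ha : a ∈ unitDisk) (hb : b ∈ unitDisk) (hs0 : 0 < s) (hs1 : s < 1)
    {z : ℂ} (hz : z = 0 ∨ z = b) : hypDeriv (doubleCover a b s) z = s * ‖b‖ := by
  have hzD : z ∈ unitDisk := by
    rcases hz with rfl | rfl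
    exacts [zero_mem_unitDisk, hb]
  have hB := mul_diskMap_mem_hol hb hs0 hs1
  have hm := diskMap_mem_hol (neg_mem_unitDisk ha)
  rw [doubleCover, hypDeriv_comp (g := fun z => (s : ℂ) * (z * diskMap b z))
    (Hol.differentiableAt hm (hB.2 hzD)) (Hol.differentiableAt hB hzD)
    (hB.2 hzD), hypDeriv_diskMap (neg_mem_unitDisk ha) (hB.2 hzD), one_mul, hypDeriv,
    (hasDerivAt_mul_diskMap hb s hzD).deriv]
  rcases hz with rfl | rfl
  · simp [diskMap_zero_right, abs_of_pos hs0]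
  · have h := (one_sub_norm_sq_pos hb).ne'
    simp only [diskMap_self, mul_zero, zero_add, norm_mul, norm_div, norm_pow, norm_zero,
      norm_one_sub_conj_mul_self hb, Complex.norm_real, Real.norm_of_nonneg hs0.le]
    field_simp
    simp

end DoubleCover

/-- Radii in `(0, 1)` whose partial products telescope and are bounded below by `1 / 2`. -/
theorem exists_radii_telescoping : ∃ s c : ℕ → ℝ, (∀ n, 0 < s n ∧ s n < 1) ∧
    (∀ n, 1 ≤ c n) ∧ c 0 = 2 ∧ ∀ n, c n * s n = c (n + 1) := by
  refine ⟨fun n => (1 + 1 / ((n : ℝ) + 2)) / (1 + 1 / ((n : ℝ) + 1)),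
    fun n => 1 + 1 / ((n : ℝ) + 1), fun n => ⟨by positivity, ?_⟩, fun n => ?_, by norm_num,
    fun n => ?_⟩
  · rw [div_lt_one (by positivity)]
    gcongr
    norm_num
  · have : 0 < 1 / ((n : ℝ) + 1) := by positivity
    linarith
  · rw [mul_div_cancel₀ _ (by positivity)]
    push_cast
    ring

theorem not_isDegenerate_of_not_isRhoBloch {X : Set ℂ} (hX : X ⊆ unitDisk)
    (hB : ¬ IsRhoBloch X) : ¬ IsDegenerate X := by
  obtain ⟨s, c, hs, hc1, hc0, hc⟩ := exists_radii_telescoping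
  choose a ha hsa haX using fun n => exists_pseudoDisk_subset_le_norm hB (hs n).1 (hs n).2
  set f : ℕ → ℂ → ℂ := fun n => doubleCover (a n) (a (n + 1)) (s n) with hf_def
  have hf : ∀ n, f n ∈ Hol X := fun n =>
    Hol.mono (haX n) (doubleCover_mem_hol (ha n) (ha (n + 1)) (hs n).1 (hs n).2)
  have hF := fun n => iterSystem_mem_hol hX hf n
  have hval : ∀ n, ∀ z, z = 0 ∨ z = a (n + 1) → f n z = a n := by
    rintro n z (rfl | rfl)
    exacts [doubleCover_zero _ _ _, doubleCover_self _ _ _]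
  have hmem : ∀ n, ∀ z, z = 0 ∨ z = a (n + 1) → z ∈ unitDisk := by
    rintro n z (rfl | rfl)
    exacts [zero_mem_unitDisk, ha _]
  have hder : ∀ n, ∀ z, z = 0 ∨ z = a (n + 1) → s n * s (n + 1) ≤ hypDeriv (f n) z := by
    intro n z hz
    rw [hypDeriv_doubleCover (ha n) (ha (n + 1)) (hs n).1 (hs n).2 hz]
    exact mul_le_mul_of_nonneg_left (hsa _) (hs n).1.le
  have hcpos : ∀ n, 0 < c n := fun n => one_pos.trans_le (hc1 n)
  -- By telescoping, `∏ j ≤ n, s j * s (j + 1)` equals `c (n + 1) * c (n + 2) / (c 0 * c 1)`. The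
  -- induction passes through `a (n + 1)`; only `z = 0` is used afterwards.
  have hinv : ∀ n, ∀ z, z = 0 ∨ z = a (n + 1) → iterSystem f n z = a 0 ∧
      c (n + 1) * c (n + 2) ≤ c 0 * c 1 * hypDeriv (iterSystem f n) z := by
    intro n
    induction n with
    | zero =>
      intro z hz
      refine ⟨hval 0 z hz, ?_⟩
      rw [← hc 1, ← hc 0]
      have := mul_le_mul_of_nonneg_left (hder 0 z hz) (mul_pos (hcpos 0) (hcpos 1)).le
      rw [← hc 0] at this
      refine le_trans (le_of_eq ?_) this
      ring
    | succ n ih =>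
      intro z hz
      obtain ⟨h1, h2⟩ := ih (a (n + 1)) (Or.inr rfl)
      have hz' := hval (n + 1) z hz
      refine ⟨by rw [← h1, ← hz']; rfl, ?_⟩
      rw [hypDeriv_iterSystem_succ hX hf n (hmem _ z hz), hz', ← mul_assoc, ← hc (n + 2),
        ← hc (n + 1)]
      have := mul_le_mul h2 (hder (n + 1) z hz) (mul_pos (hs _).1 (hs _).1).le
        ((mul_pos (hcpos _) (hcpos _)).le.trans h2)
      rw [← hc (n + 1)] at this
      refine le_trans (le_of_eq ?_) this
      ring
  have hlow : ∀ n, (1 - ‖a 0‖ ^ 2) / (c 0 * c 1) ≤ ‖deriv (iterSystem f n) 0‖ := by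
    intro n
    obtain ⟨h1, h2⟩ := hinv n 0 (Or.inl rfl)
    have h0 := one_sub_norm_sq_pos (ha 0)
    have h3 := one_le_mul_of_one_le_of_one_le (hc1 (n + 1)) (hc1 (n + 2))
    have h4 := h3.trans h2
    rw [hypDeriv, h1, norm_zero, ← mul_div_assoc, le_div_iff₀ h0] at h4
    rw [div_le_iff₀ (mul_pos (hcpos 0) (hcpos 1))]
    linarith
  intro hdeg
  obtain ⟨G, hG⟩ := exists_isAccumulationPoint (fun n => (hF n).1)
    fun n z hz => (mem_unitDisk.1 (hX ((hF n).2 hz))).le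
  obtain ⟨w, hw⟩ := hdeg f hf G hG
  obtain ⟨φ, -, hφ⟩ := hG
  have h1 : Tendsto (fun n => deriv (iterSystem f (φ n)) 0) atTop (𝓝 (deriv G 0)) :=
    (hφ.deriv (Eventually.of_forall fun n => (hF (φ n)).1) isOpen_unitDisk).tendsto_at
      zero_mem_unitDisk
  have hGw : G =ᶠ[𝓝 0] fun _ => w :=
    eventually_of_mem (isOpen_unitDisk.mem_nhds zero_mem_unitDisk) hw
  have h2 := ge_of_tendsto' h1.norm fun n => hlow (φ n)
  rw [hGw.deriv_eq, deriv_const, norm_zero] at h2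
  exact h2.not_gt (div_pos (one_sub_norm_sq_pos (ha 0)) (mul_pos (hcpos 0) (hcpos 1)))

end HolIter

theorem corollary1p3 (X : Set ℂ) (hX : HolIter.IsSubdomain X) :
    HolIter.IsRhoBloch X ↔ HolIter.IsDegenerate X :=
  ⟨fun h => h.isDegenerate hX.2.2, fun h => by
    by_contra hB
    exact HolIter.not_isDegenerate_of_not_isRhoBloch hX.2.2 hB h⟩
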